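/- Conventions. A Hilbert $\mathcal B$-module over a $C^*$-algebra $\mathcal B$ is a right module $\mathbf E$ with a $\mathcal B$-valued inner product $\langle\cdot\mid\cdot\rangle_{\mathbf E}$, conjugate linear in the first and linear in the second variable, complete in the norm $\|e\|=\|\langle e\mid e\rangle_{\mathbf E}\|^{1/2}$. For $e_1,e_2\in\mathbf E$ let $|e_1\rangle\langle e_2|$ be the operator $f\mapsto e_1\langle e_2\mid f\rangle_{\mathbf E}$ on $\mathbf E$. For a family $(T_x)_{x\in X}$ of bounded operators on a Banach space $V$ and a bounded operator $S$ on $V$, the identity $\int_X T_x\,d\mu(x)=S$ is meant in the weak operator topology: for every $v\in V$ and every bounded linear functional $\Lambda$ on $V$, the function $x\mapsto\Lambda(T_xv)$ is integrable and $\int_X\Lambda(T_xv)\,d\mu(x)=\Lambda(Sv)$. Lemma (resolution of the identity for module valued coherent states). Let $\mathcal A,\mathcal B$ be unital $C^*$-algebras, $\mathcal C$ a $C^*$-algebra, $\mathbf E$ a Hilbert $\mathcal B$-module with a left action of $\mathcal A$ given by a unital $*$-homomorphism from $\mathcal A$ into the adjointable operators on $\mathbf E$, and $\mathbf G$ a Hilbert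 $\mathcal C$-module. Let $(X,\mu)$ be a finite measure space. Let $F_0,F_1,\dots$ be a finite or infinite sequence of strongly measurable functions $F_k:X\to\mathbf E$ for which $x\mapsto\langle F_k(x)\mid F_k(x)\rangle_{\mathbf E}$ is Bochner integrable, such that $$\int_X|F_k(x)\rangle\langle F_\ell(x)|\,d\mu(x)=\delta_{k\ell}\,I_{\mathbf E}\qquad\text{for all }k,\ell ,$$ and let $\phi_0,\phi_1,\dots$ be elements of $\mathbf G$, indexed by the same set, such that $\sum_k|\phi_k\rangle\langle\phi_k|=I_{\mathbf G}$, that is, $\sum_k\phi_k\langle\phi_k\mid g\rangle_{\mathbf G}=g$ in norm for every $g\in\mathbf G$. Let $\mathbf H=\mathbf E\otimes\mathbf G$ be the exterior tensor product, a Hilbert module over the minimal (spatial) tensor product $\mathcal B\otimes\mathcal C$, with $\langle e\otimes g\mid e'\otimes g'\rangle_{\mathbf H}=\langle e\mid e'\rangle_{\mathbf E}\otimes\langle g\mid g'\rangle_{\mathbf G}$. Let $a\in\mathcal A$ be a co-isometry, $aa^*=1_{\mathcal A}$, and assume that for every $x\in X$ the series $$|x,a\rangle=\sum_k aF_k(x)\otimes\phi_k$$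 converges in norm in $\mathbf H$. Then $$\int_X|x,a\rangle\langle x,a|\,d\mu(x)=I_{\mathbf H}.$$ -/

import Mathlib

open MulOpposite MeasureTheory Filter Topology UniformSpace
open scoped TensorProduct ComplexOrder ENNReal InnerProductSpace

noncomputable section

namespace HilbertMod

/-! ### Hilbert C⋆-modules

A right Hilbert C⋆-module over `B` is a complete `CStarModule Bᵐᵒᵖ E`: the right action of `b` is
`op b • e`, and the `B`-valued inner product, conjugate linear in the first variable, is the
following `rinner`. -/

section Basic

variable (B : Type*) {E : Type*} [NonUnitalCStarAlgebra B] [PartialOrder B]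
  [NormedAddCommGroup E] [NormedSpace ℂ E] [SMul Bᵐᵒᵖ E] [CStarModule Bᵐᵒᵖ E]

/-- The `B`-valued inner product `⟨e | f⟩` of a right Hilbert `B`-module. -/
def rinner (e f : E) : B := unop (inner Bᵐᵒᵖ e f)

/-- The operator `|e₁⟩⟨e₂| : f ↦ e₁ ⟨e₂ | f⟩`. -/
def ketBra (e₁ e₂ f : E) : E := op (rinner B e₂ f) • e₁

variable {B}

lemma rinner_add_right (e f g : E) : rinner B e (f + g) = rinner B e f + rinner B e g := by
  simp [rinner]

lemma rinner_add_left (e f g : E) : rinner B (e + f) g = rinner B e g + rinner B f g := by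
  simp [rinner]

lemma rinner_smul_right (z : ℂ) (e f : E) : rinner B e (z • f) = z • rinner B e f := by
  simp [rinner]

lemma rinner_smul_left (z : ℂ) (e f : E) : rinner B (z • e) f = star z • rinner B e f := by
  simp [rinner]

lemma rinner_act_right (e f : E) (b : B) : rinner B e (op b • f) = rinner B e f * b := by
  simp [rinner]

lemma star_rinner (e f : E) : star (rinner B e f) = rinner B f e := by
  rw [rinner, ← unop_star, CStarModule.star_inner, rinner]

lemma rinner_act_left (e f : E) (b : B) : rinner B (op b • e) f = star b * rinner B e f := by
  rw [← star_rinner, rinner_act_right, star_mul, star_rinner]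

lemma rinner_self_nonneg (e : E) : 0 ≤ rinner B e e :=
  CStarModule.inner_self_nonneg (A := Bᵐᵒᵖ) (x := e)

lemma rinner_ext {e f : E} (h : ∀ g : E, rinner B g e = rinner B g f) : e = f := by
  have h1 : rinner B (e - f) (e - f) = 0 := by
    have h2 := h (e - f)
    rw [← sub_eq_zero] at h2
    rw [← h2, sub_eq_add_neg, rinner_add_right, sub_eq_add_neg]
    congr 1
    simp [rinner]
  have h3 : inner Bᵐᵒᵖ (e - f) (e - f) = 0 := by
    rw [← unop_inj]; exact h1
  exact sub_eq_zero.mp (CStarModule.inner_self.mp h3)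

lemma norm_rinner_self (e : E) : ‖rinner B e e‖ = ‖e‖ ^ 2 := by
  rw [CStarModule.norm_eq_sqrt_norm_inner_self (A := Bᵐᵒᵖ) e, Real.sq_sqrt (norm_nonneg _)]
  rfl

lemma act_add (e : E) (b c : B) : op (b + c) • e = op b • e + op c • e :=
  rinner_ext (B := B) fun g => by
    simp only [rinner_act_right, rinner_add_right, mul_add]

lemma act_smul (e : E) (z : ℂ) (b : B) : op (z • b) • e = z • (op b • e) :=
  rinner_ext (B := B) fun g => by
    simp only [rinner_act_right, rinner_smul_right, mul_smul_comm]

lemma add_act (e f : E) (b : B) : op b • (e + f) = op b • e + op b • f :=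
  rinner_ext (B := B) fun g => by simp [rinner_act_right, rinner_add_right, add_mul]

lemma smul_act (e : E) (z : ℂ) (b : B) : op b • (z • e) = z • (op b • e) :=
  rinner_ext (B := B) fun g => by simp [rinner_act_right, rinner_smul_right, smul_mul_assoc]

lemma act_act (e : E) (b c : B) : op c • (op b • e) = op (b * c) • e :=
  rinner_ext (B := B) fun g => by simp only [rinner_act_right, mul_assoc]

end Basic

/-! ### Localisation at a positive functional

For a positive functional `φ` on `B`, the Hilbert space `Loc φ E` is the completion of `E` in the
scalar inner product `φ ⟨e | f⟩`. An element `e` of `E` acts as the operator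
`θ φ e : φ.GNS → Loc φ E`, `[b] ↦ [e b]`, and `θ φ e† ∘ θ φ f` is the GNS image of `⟨e | f⟩`. -/

section Loc

variable {B : Type*} [NonUnitalCStarAlgebra B] [PartialOrder B] (φ : B →ₚ[ℂ] ℂ)
  (E : Type*) [NormedAddCommGroup E] [NormedSpace ℂ E] [SMul Bᵐᵒᵖ E] [CStarModule Bᵐᵒᵖ E]

set_option linter.unusedVariables false in
/-- A copy of `E`, to carry the scalar (semi-)inner product `φ ⟨e | f⟩`. -/
@[nolint unusedArguments]
def PreLoc (φ : B →ₚ[ℂ] ℂ) (E : Type*) := E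

instance : AddCommGroup (PreLoc φ E) := inferInstanceAs (AddCommGroup E)
instance : Module ℂ (PreLoc φ E) := inferInstanceAs (Module ℂ E)

/-- The identity map from `E` to its copy. -/
def toPreLoc : E ≃ₗ[ℂ] PreLoc φ E := LinearEquiv.refl ℂ _

/-- The identity map from the copy of `E` to `E`. -/
def ofPreLoc : PreLoc φ E ≃ₗ[ℂ] E := (toPreLoc φ E).symm

variable [StarOrderedRing B]

/-- The semi-inner product `φ ⟨e | f⟩`. -/
abbrev preLocCore : PreInnerProductSpace.Core ℂ (PreLoc φ E) where
  inner e f := φ (rinner B (ofPreLoc φ E e) (ofPreLoc φ E f))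
  conj_inner_symm e f := by
    rw [← star_rinner, map_star φ]; simp
  re_inner_nonneg e := (RCLike.nonneg_iff.mp (φ.map_nonneg (rinner_self_nonneg _))).1
  add_left _ _ _ := by rw [map_add, rinner_add_left, map_add]
  smul_left _ _ _ := by simp [rinner_smul_left]

instance : SeminormedAddCommGroup (PreLoc φ E) :=
  InnerProductSpace.Core.toSeminormedAddCommGroup (c := preLocCore φ E)
instance : InnerProductSpace ℂ (PreLoc φ E) := InnerProductSpace.ofCore (preLocCore φ E)

/-- The Hilbert space completion of `E` in the inner product `φ ⟨e | f⟩`. -/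
abbrev Loc := Completion (PreLoc φ E)

variable {E}

lemma preLoc_inner (e f : E) :
    ⟪toPreLoc φ E e, toPreLoc φ E f⟫_ℂ = φ (rinner B e f) := rfl

lemma preLoc_norm_sq (e : E) : ((‖toPreLoc φ E e‖ ^ 2 : ℝ) : ℂ) = φ (rinner B e e) := by
  rw [← preLoc_inner, inner_self_eq_norm_sq_to_K]; simp

/-- The map `[b] ↦ [e b]` before completion. -/
def preθ (e : E) : φ.PreGNS →L[ℂ] PreLoc φ E :=
  LinearMap.mkContinuous
    { toFun := fun b => toPreLoc φ E (op (φ.ofPreGNS b) • e)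
      map_add' := fun b c => by rw [map_add, act_add, map_add]
      map_smul' := fun z b => by
        rw [map_smul φ.ofPreGNS, act_smul, map_smul (toPreLoc φ E)]; rfl } ‖e‖ fun b => by
    rw [← sq_le_sq₀ (by positivity) (by positivity), mul_pow, ← Complex.real_le_real]
    have h := CStarAlgebra.star_left_conjugate_le_norm_smul (a := φ.ofPreGNS b)
      (b := rinner B e e) (hb := by exact IsSelfAdjoint.of_nonneg (rinner_self_nonneg e))
    have h2 := OrderHomClass.mono φ h
    simp only [LinearMap.coe_mk, AddHom.coe_mk]
    rw [preLoc_norm_sq, rinner_act_right, rinner_act_left]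
    refine h2.trans_eq ?_
    rw [norm_rinner_self, Complex.ofReal_mul, Complex.ofReal_pow ‖b‖,
      PositiveLinearMap.preGNS_norm_sq φ b, ← Complex.coe_smul, map_smul, smul_eq_mul]

/-- The operator `[b] ↦ [e b]` from the GNS space of `φ` to the localisation of `E`. -/
def θ (e : E) : φ.GNS →L[ℂ] Loc φ E := (preθ φ e).completion

@[simp] lemma θ_coe (e : E) (b : φ.PreGNS) :
    θ φ e (b : φ.GNS) = ((toPreLoc φ E (op (φ.ofPreGNS b) • e) : PreLoc φ E) : Loc φ E) :=
  ContinuousLinearMap.completion_apply_coe _ _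

lemma norm_θ_le (e : E) : ‖θ φ e‖ ≤ ‖e‖ := by
  refine ContinuousLinearMap.opNorm_le_bound _ (norm_nonneg _) fun x => ?_
  induction x using Completion.induction_on with
  | hp => apply isClosed_le <;> fun_prop
  | ih b =>
    rw [θ, ContinuousLinearMap.completion_apply_coe, Completion.norm_coe, Completion.norm_coe]
    exact (preθ φ e).le_of_opNorm_le (LinearMap.mkContinuous_norm_le _ (norm_nonneg _) _) b

/-- `θ` intertwines the right action of `B` with the GNS representation. -/
lemma θ_act (e : E) (b : B) : θ φ (op b • e) = θ φ e ∘L φ.gnsNonUnitalStarAlgHom b := by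
  ext x
  induction x using Completion.induction_on with
  | hp => apply isClosed_eq <;> fun_prop
  | ih c =>
    rw [ContinuousLinearMap.comp_apply, PositiveLinearMap.gnsNonUnitalStarAlgHom_apply_coe,
      θ_coe, θ_coe, act_act]
    rfl

/-- `θ φ e† ∘ θ φ f` is the GNS image of `⟨e | f⟩`. -/
lemma adjoint_θ_comp_θ (e f : E) :
    (θ φ e).adjoint ∘L θ φ f = φ.gnsNonUnitalStarAlgHom (rinner B e f) := by
  ext x
  refine ext_inner_left ℂ fun y => ?_
  rw [ContinuousLinearMap.comp_apply, ContinuousLinearMap.adjoint_inner_right]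
  induction x, y using Completion.induction_on₂ with
  | hp => apply isClosed_eq <;> fun_prop
  | ih b c =>
    rw [PositiveLinearMap.gnsNonUnitalStarAlgHom_apply_coe, θ_coe, θ_coe, Completion.inner_coe,
      Completion.inner_coe, preLoc_inner, rinner_act_right, rinner_act_left,
      PositiveLinearMap.preGNS_inner_def]
    simp [mul_assoc]

end Loc

/-! ### Tensor products of Hilbert space operators -/

section Tensor

variable {K₁ K₂ L₁ L₂ M₁ M₂ : Type*}
  [NormedAddCommGroup K₁] [InnerProductSpace ℂ K₁] [NormedAddCommGroup K₂] [InnerProductSpace ℂ K₂]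
  [NormedAddCommGroup L₁] [InnerProductSpace ℂ L₁] [NormedAddCommGroup L₂] [InnerProductSpace ℂ L₂]
  [NormedAddCommGroup M₁] [InnerProductSpace ℂ M₁] [NormedAddCommGroup M₂] [InnerProductSpace ℂ M₂]

/-- The operator `S ⊗ T`, on the completions. -/
def preOpTensor (S : K₁ →L[ℂ] L₁) (T : K₂ →L[ℂ] L₂) :
    Completion (K₁ ⊗[ℂ] K₂) →L[ℂ] Completion (L₁ ⊗[ℂ] L₂) :=
  (TensorProduct.mapL S T).completion

lemma norm_preOpTensor_le (S : K₁ →L[ℂ] L₁) (T : K₂ →L[ℂ] L₂) : ‖preOpTensor S T‖ ≤ ‖S‖ * ‖T‖ := by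
  refine ContinuousLinearMap.opNorm_le_bound _ (by positivity) fun x => ?_
  induction x using Completion.induction_on with
  | hp => apply isClosed_le <;> fun_prop
  | ih t =>
    rw [preOpTensor, ContinuousLinearMap.completion_apply_coe, Completion.norm_coe,
      Completion.norm_coe]
    exact (TensorProduct.mapL S T).le_of_opNorm_le (TensorProduct.norm_mapL_le _ _) t

lemma preOpTensor_comp (S : L₁ →L[ℂ] M₁) (T : L₂ →L[ℂ] M₂) (S' : K₁ →L[ℂ] L₁) (T' : K₂ →L[ℂ] L₂) :
    preOpTensor S T ∘L preOpTensor S' T' = preOpTensor (S ∘L S') (T ∘L T') := by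
  ext x
  induction x using Completion.induction_on with
  | hp => apply isClosed_eq <;> fun_prop
  | ih t =>
    rw [ContinuousLinearMap.comp_apply]
    simp only [preOpTensor, ContinuousLinearMap.completion_apply_coe, TensorProduct.mapL_comp,
      ContinuousLinearMap.comp_apply]

lemma preOpTensor_adjoint [CompleteSpace K₁] [CompleteSpace K₂] [CompleteSpace L₁] [CompleteSpace L₂]
    (S : K₁ →L[ℂ] L₁) (T : K₂ →L[ℂ] L₂) :
    (preOpTensor S T).adjoint = preOpTensor S.adjoint T.adjoint := by
  symm
  rw [ContinuousLinearMap.eq_adjoint_iff]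
  intro x y
  induction x, y using Completion.induction_on₂ with
  | hp => apply isClosed_eq <;> fun_prop
  | ih s t =>
    simp only [preOpTensor, ContinuousLinearMap.completion_apply_coe, Completion.inner_coe]
    induction s with
    | zero => simp
    | add s s' hs hs' => simp only [map_add, inner_add_left, hs, hs']
    | tmul s₁ s₂ =>
      induction t with
      | zero => simp
      | add t t' ht ht' => simp only [map_add, inner_add_right, ht, ht']
      | tmul t₁ t₂ => simp [ContinuousLinearMap.adjoint_inner_left]

/-- The Hilbert space tensor product. -/
def HTensor (K L : Type*) [NormedAddCommGroup K] [InnerProductSpace ℂ K] [NormedAddCommGroup L]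
    [InnerProductSpace ℂ L] : Type _ := Completion (K ⊗[ℂ] L)

instance : NormedAddCommGroup (HTensor K₁ K₂) :=
  inferInstanceAs (NormedAddCommGroup (Completion (K₁ ⊗[ℂ] K₂)))

instance : InnerProductSpace ℂ (HTensor K₁ K₂) :=
  inferInstanceAs (InnerProductSpace ℂ (Completion (K₁ ⊗[ℂ] K₂)))

instance : CompleteSpace (HTensor K₁ K₂) :=
  inferInstanceAs (CompleteSpace (Completion (K₁ ⊗[ℂ] K₂)))

/-- The operator `S ⊗ T` between Hilbert space tensor products. -/
def opTensor (S : K₁ →L[ℂ] L₁) (T : K₂ →L[ℂ] L₂) : HTensor K₁ K₂ →L[ℂ] HTensor L₁ L₂ :=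
  preOpTensor S T

lemma norm_opTensor_le (S : K₁ →L[ℂ] L₁) (T : K₂ →L[ℂ] L₂) : ‖opTensor S T‖ ≤ ‖S‖ * ‖T‖ :=
  norm_preOpTensor_le S T

lemma opTensor_comp (S : L₁ →L[ℂ] M₁) (T : L₂ →L[ℂ] M₂) (S' : K₁ →L[ℂ] L₁) (T' : K₂ →L[ℂ] L₂) :
    opTensor S T ∘L opTensor S' T' = opTensor (S ∘L S') (T ∘L T') :=
  preOpTensor_comp S T S' T'

lemma opTensor_adjoint [CompleteSpace K₁] [CompleteSpace K₂] [CompleteSpace L₁] [CompleteSpace L₂]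
    (S : K₁ →L[ℂ] L₁) (T : K₂ →L[ℂ] L₂) :
    (opTensor S T).adjoint = opTensor S.adjoint T.adjoint :=
  preOpTensor_adjoint S T

end Tensor

/-! ### The minimal tensor product of two C⋆-algebras

It is the closed star subalgebra generated by the elementary tensors in the representation
`⨁ πφ ⊗ πψ`, over all pairs of positive functionals `φ` on `B` and `ψ` on `C`, where `πφ` is the
GNS representation. Since `⨁ πφ` and `⨁ πψ` are faithful, this is the spatial tensor product. The
block diagonal operators are stored as bounded families. -/

section MinTensor

variable (B C : Type*) [NonUnitalCStarAlgebra B] [PartialOrder B] [StarOrderedRing B]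
  [NonUnitalCStarAlgebra C] [PartialOrder C] [StarOrderedRing C]

/-- Pairs of positive functionals. -/
abbrev Pairs := (B →ₚ[ℂ] ℂ) × (C →ₚ[ℂ] ℂ)

variable {B C} in
/-- The Hilbert space tensor product of the two GNS spaces. -/
abbrev GNS₂ (i : Pairs B C) := HTensor i.1.GNS i.2.GNS

instance (i : Pairs B C) : NonUnitalCStarAlgebra (GNS₂ i →L[ℂ] GNS₂ i) := inferInstance

/-- Bounded families of operators on the spaces `GNS₂ i`. -/
def Blocks : Type _ := lp (fun i : Pairs B C => GNS₂ i →L[ℂ] GNS₂ i) ∞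

instance : NonUnitalCStarAlgebra (Blocks B C) :=
  inferInstanceAs (NonUnitalCStarAlgebra (lp (fun i : Pairs B C => GNS₂ i →L[ℂ] GNS₂ i) ∞))

variable {B C} in
/-- The elementary tensor `b ⊗ c` in the representation `⨁ πφ ⊗ πψ`. -/
def blockTmul (b : B) (c : C) : Blocks B C :=
  ⟨fun i => opTensor (i.1.gnsNonUnitalStarAlgHom b) (i.2.gnsNonUnitalStarAlgHom c),
    memℓp_infty ⟨‖b‖ * ‖c‖, by
      rintro _ ⟨i, rfl⟩
      exact (norm_opTensor_le _ _).trans (mul_le_mul (NonUnitalStarAlgHom.norm_apply_le _ _)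
        (NonUnitalStarAlgHom.norm_apply_le _ _) (norm_nonneg _) (norm_nonneg _))⟩⟩

/-- The minimal (spatial) tensor product of the C⋆-algebras `B` and `C`, as a closed star
subalgebra. -/
def minTensor : NonUnitalStarSubalgebra ℂ (Blocks B C) :=
  (NonUnitalStarAlgebra.adjoin ℂ
    (Set.range fun p : B × C => blockTmul p.1 p.2)).topologicalClosure

/-- The minimal (spatial) tensor product `B ⊗ C`. -/
def MinTensor : Type _ := minTensor B C

instance : NonUnitalCStarAlgebra (MinTensor B C) :=
  NonUnitalStarSubalgebra.nonUnitalCStarAlgebra (minTensor B C)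
    (h_closed := NonUnitalStarSubalgebra.isClosed_topologicalClosure _)

instance : PartialOrder (MinTensor B C) := CStarAlgebra.spectralOrder _

instance : StarOrderedRing (MinTensor B C) := CStarAlgebra.spectralOrderedRing _

variable {B C} in
/-- The elementary tensor `b ⊗ c` in the minimal tensor product. -/
def algTmul (b : B) (c : C) : MinTensor B C :=
  ⟨blockTmul b c, NonUnitalStarSubalgebra.le_topologicalClosure _
    (NonUnitalStarAlgebra.subset_adjoin _ _ ⟨(b, c), rfl⟩)⟩

variable {B C}

/-- The block of `d` at the pair `i`. -/
def Blocks.at (d : Blocks B C) (i : Pairs B C) : GNS₂ i →L[ℂ] GNS₂ i := d.1 i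

lemma Blocks.ext {d d' : Blocks B C} (h : ∀ i, d.at i = d'.at i) : d = d' :=
  Subtype.ext (funext h)

lemma Blocks.add_at (d d' : Blocks B C) (i : Pairs B C) : (d + d').at i = d.at i + d'.at i := rfl
lemma Blocks.neg_at (d : Blocks B C) (i : Pairs B C) : (-d).at i = -d.at i := rfl
lemma Blocks.smul_at (z : ℂ) (d : Blocks B C) (i : Pairs B C) : (z • d).at i = z • d.at i := rfl
lemma Blocks.zero_at (i : Pairs B C) : (0 : Blocks B C).at i = 0 := rfl
lemma Blocks.mul_at (d d' : Blocks B C) (i : Pairs B C) : (d * d').at i = d.at i ∘L d'.at i := rfl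
lemma Blocks.star_at (d : Blocks B C) (i : Pairs B C) : (star d).at i = (d.at i).adjoint := rfl

lemma Blocks.norm_at_le (d : Blocks B C) (i : Pairs B C) : ‖d.at i‖ ≤ ‖d‖ :=
  lp.norm_apply_le_norm ENNReal.top_ne_zero _ i

lemma Blocks.norm_le {d : Blocks B C} {M : ℝ} (hM : 0 ≤ M) (h : ∀ i, ‖d.at i‖ ≤ M) : ‖d‖ ≤ M :=
  lp.norm_le_of_forall_le hM h

lemma blockTmul_at (b : B) (c : C) (i : Pairs B C) : (blockTmul b c).at i =
    opTensor (i.1.gnsNonUnitalStarAlgHom b) (i.2.gnsNonUnitalStarAlgHom c) := rfl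

lemma star_blockTmul (b : B) (c : C) : star (blockTmul b c) = blockTmul (star b) (star c) :=
  Blocks.ext fun i => by
    rw [Blocks.star_at, blockTmul_at, blockTmul_at, opTensor_adjoint, map_star, map_star]
    rfl

end MinTensor

/-! ### The exterior tensor product of two Hilbert modules

An elementary tensor `e ⊗ g` is stored as the bounded family of the operators `θ φ e ⊗ θ ψ g`,
and `E ⊗ G` is the closed linear span of the elementary tensors. In this picture the inner product
of `S` and `T` is `S† T`, and the right action of the minimal tensor product is composition. On
elementary tensors these are `⟨e ⊗ g | e' ⊗ g'⟩ = ⟨e | e'⟩ ⊗ ⟨g | g'⟩` (`rinner_tmul`) and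
`(e ⊗ g)(b ⊗ c) = e b ⊗ g c` (`tmul_act`). -/

section ExtTensor

variable (B C E G : Type*)
  [NonUnitalCStarAlgebra B] [PartialOrder B] [StarOrderedRing B]
  [NonUnitalCStarAlgebra C] [PartialOrder C] [StarOrderedRing C]
  [NormedAddCommGroup E] [NormedSpace ℂ E] [SMul Bᵐᵒᵖ E] [CStarModule Bᵐᵒᵖ E]
  [NormedAddCommGroup G] [NormedSpace ℂ G] [SMul Cᵐᵒᵖ G] [CStarModule Cᵐᵒᵖ G]

variable {B C} in
/-- The Hilbert space tensor product of the two localisations. -/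
abbrev Loc₂ (i : Pairs B C) := HTensor (Loc i.1 E) (Loc i.2 G)

/-- Bounded families of operators `GNS₂ i → Loc₂ i`. -/
def ModBlocks : Type _ := lp (fun i : Pairs B C => GNS₂ i →L[ℂ] Loc₂ E G i) ∞

instance : NormedAddCommGroup (ModBlocks B C E G) :=
  inferInstanceAs (NormedAddCommGroup (lp (fun i : Pairs B C => GNS₂ i →L[ℂ] Loc₂ E G i) ∞))

instance : NormedSpace ℂ (ModBlocks B C E G) :=
  inferInstanceAs (NormedSpace ℂ (lp (fun i : Pairs B C => GNS₂ i →L[ℂ] Loc₂ E G i) ∞))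

instance : CompleteSpace (ModBlocks B C E G) :=
  lp.completeSpace (E := fun i : Pairs B C => GNS₂ i →L[ℂ] Loc₂ E G i) (p := ∞)

variable {B C E G}

/-- The block of `T` at the pair `i`. -/
def ModBlocks.at (T : ModBlocks B C E G) (i : Pairs B C) : GNS₂ i →L[ℂ] Loc₂ E G i := T.1 i

lemma ModBlocks.ext {S T : ModBlocks B C E G} (h : ∀ i, S.at i = T.at i) : S = T :=
  Subtype.ext (funext h)

lemma ModBlocks.add_at (S T : ModBlocks B C E G) (i : Pairs B C) :
    (S + T).at i = S.at i + T.at i := rfl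
lemma ModBlocks.smul_at (z : ℂ) (T : ModBlocks B C E G) (i : Pairs B C) :
    (z • T).at i = z • T.at i := rfl
lemma ModBlocks.zero_at (i : Pairs B C) : (0 : ModBlocks B C E G).at i = 0 := rfl

lemma ModBlocks.norm_at_le (T : ModBlocks B C E G) (i : Pairs B C) : ‖T.at i‖ ≤ ‖T‖ :=
  lp.norm_apply_le_norm ENNReal.top_ne_zero _ i

lemma ModBlocks.norm_le {T : ModBlocks B C E G} {M : ℝ} (hM : 0 ≤ M) (h : ∀ i, ‖T.at i‖ ≤ M) :
    ‖T‖ ≤ M :=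
  lp.norm_le_of_forall_le hM h

/-- The elementary tensor `e ⊗ g`, as a bounded family of operators. -/
def modTmul (e : E) (g : G) : ModBlocks B C E G :=
  ⟨fun i => opTensor (θ i.1 e) (θ i.2 g), memℓp_infty ⟨‖e‖ * ‖g‖, by
    rintro _ ⟨i, rfl⟩
    exact (norm_opTensor_le _ _).trans (mul_le_mul (norm_θ_le _ _)
      (norm_θ_le _ _) (norm_nonneg _) (norm_nonneg _))⟩⟩

lemma modTmul_at (e : E) (g : G) (i : Pairs B C) :
    (modTmul e g : ModBlocks B C E G).at i = opTensor (θ i.1 e) (θ i.2 g) := rfl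

/-- The family of the compositions `T d`. -/
def modAct (T : ModBlocks B C E G) (d : Blocks B C) : ModBlocks B C E G :=
  ⟨fun i => T.at i ∘L d.at i, memℓp_infty ⟨‖T‖ * ‖d‖, by
    rintro _ ⟨i, rfl⟩
    exact (ContinuousLinearMap.opNorm_comp_le _ _).trans (mul_le_mul (T.norm_at_le i)
      (d.norm_at_le i) (norm_nonneg _) (norm_nonneg _))⟩⟩

/-- The family of the operators `S† T`. -/
def modInner (S T : ModBlocks B C E G) : Blocks B C :=
  ⟨fun i => (S.at i).adjoint ∘L T.at i, memℓp_infty ⟨‖S‖ * ‖T‖, by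
    rintro _ ⟨i, rfl⟩
    refine (ContinuousLinearMap.opNorm_comp_le _ _).trans ?_
    rw [LinearIsometryEquiv.norm_map]
    exact mul_le_mul (S.norm_at_le i) (T.norm_at_le i) (norm_nonneg _) (norm_nonneg _)⟩⟩

lemma modAct_at (T : ModBlocks B C E G) (d : Blocks B C) (i : Pairs B C) :
    (modAct T d).at i = T.at i ∘L d.at i := rfl

lemma modInner_at (S T : ModBlocks B C E G) (i : Pairs B C) :
    (modInner S T).at i = (S.at i).adjoint ∘L T.at i := rfl

lemma norm_modAct_le (T : ModBlocks B C E G) (d : Blocks B C) : ‖modAct T d‖ ≤ ‖T‖ * ‖d‖ :=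
  ModBlocks.norm_le (by positivity) fun i => (ContinuousLinearMap.opNorm_comp_le _ _).trans
    (mul_le_mul (T.norm_at_le i) (d.norm_at_le i) (norm_nonneg _) (norm_nonneg _))

lemma norm_modInner_le (S T : ModBlocks B C E G) : ‖modInner S T‖ ≤ ‖S‖ * ‖T‖ :=
  Blocks.norm_le (by positivity) fun i => by
    refine (ContinuousLinearMap.opNorm_comp_le _ _).trans ?_
    rw [LinearIsometryEquiv.norm_map]
    exact mul_le_mul (S.norm_at_le i) (T.norm_at_le i) (norm_nonneg _) (norm_nonneg _)

/-- `modAct` as a continuous linear map in its first argument. -/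
def modActL (d : Blocks B C) : ModBlocks B C E G →L[ℂ] ModBlocks B C E G :=
  LinearMap.mkContinuous
    { toFun := fun T => modAct T d
      map_add' := fun S T => ModBlocks.ext fun i => by
        simp only [modAct_at, ModBlocks.add_at, ContinuousLinearMap.add_comp]
      map_smul' := fun z T => ModBlocks.ext fun i => by
        simp only [modAct_at, ModBlocks.smul_at, ContinuousLinearMap.smul_comp, RingHom.id_apply] }
    ‖d‖ fun T => (norm_modAct_le T d).trans_eq (mul_comm _ _)

/-- `modAct` as a continuous linear map in its second argument. -/
def modActR (T : ModBlocks B C E G) : Blocks B C →L[ℂ] ModBlocks B C E G :=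
  LinearMap.mkContinuous
    { toFun := fun d => modAct T d
      map_add' := fun d d' => ModBlocks.ext fun i => by
        simp only [modAct_at, ModBlocks.add_at, Blocks.add_at, ContinuousLinearMap.comp_add]
      map_smul' := fun z d => ModBlocks.ext fun i => by
        simp only [modAct_at, ModBlocks.smul_at, Blocks.smul_at, ContinuousLinearMap.comp_smul,
          RingHom.id_apply] }
    ‖T‖ fun d => norm_modAct_le T d

/-- `modInner` as a continuous linear map in its second argument. -/
def modInnerR (S : ModBlocks B C E G) : ModBlocks B C E G →L[ℂ] Blocks B C :=
  LinearMap.mkContinuous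
    { toFun := fun T => modInner S T
      map_add' := fun T T' => Blocks.ext fun i => by
        simp only [modInner_at, ModBlocks.add_at, Blocks.add_at, ContinuousLinearMap.comp_add]
      map_smul' := fun z T => Blocks.ext fun i => by
        simp only [modInner_at, ModBlocks.smul_at, Blocks.smul_at, ContinuousLinearMap.comp_smul,
          RingHom.id_apply] }
    ‖S‖ fun T => norm_modInner_le S T

lemma star_modInner (S T : ModBlocks B C E G) : star (modInner S T) = modInner T S :=
  Blocks.ext fun i => by
    rw [Blocks.star_at, modInner_at, modInner_at, ContinuousLinearMap.adjoint_comp,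
      ContinuousLinearMap.adjoint_adjoint]

lemma modInner_act (S T : ModBlocks B C E G) (d : Blocks B C) :
    modInner S (modAct T d) = modInner S T * d := rfl

lemma modAct_mul (T : ModBlocks B C E G) (d d' : Blocks B C) :
    modAct T (d * d') = modAct (modAct T d) d' := rfl

lemma modInner_tmul (e e' : E) (g g' : G) :
    modInner (modTmul e g : ModBlocks B C E G) (modTmul e' g') =
      blockTmul (rinner B e e') (rinner C g g') :=
  Blocks.ext fun i => by
    rw [modInner_at, modTmul_at, modTmul_at, opTensor_adjoint, opTensor_comp, adjoint_θ_comp_θ,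
      adjoint_θ_comp_θ, blockTmul_at]

lemma modAct_tmul (e : E) (g : G) (b : B) (c : C) :
    modAct (modTmul e g : ModBlocks B C E G) (blockTmul b c) = modTmul (op b • e) (op c • g) :=
  ModBlocks.ext fun i => by
    rw [modAct_at, modTmul_at, modTmul_at, blockTmul_at, opTensor_comp, θ_act, θ_act]

variable (B C E G) in
/-- The exterior tensor product `E ⊗ G`: the closed linear span of the elementary tensors. -/
def extTensor : Submodule ℂ (ModBlocks B C E G) :=
  (Submodule.span ℂ (Set.range fun p : E × G => modTmul p.1 p.2)).topologicalClosure

variable (B C E G) in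
/-- The exterior tensor product `E ⊗ G` of a Hilbert `B`-module and a Hilbert `C`-module. -/
def ExtTensor : Type _ := extTensor B C E G

instance : NormedAddCommGroup (ExtTensor B C E G) :=
  inferInstanceAs (NormedAddCommGroup (extTensor B C E G))

instance : NormedSpace ℂ (ExtTensor B C E G) :=
  inferInstanceAs (NormedSpace ℂ (extTensor B C E G))

lemma modTmul_mem (e : E) (g : G) : modTmul e g ∈ extTensor B C E G :=
  Submodule.le_topologicalClosure _ (Submodule.subset_span ⟨(e, g), rfl⟩)

instance : CompleteSpace (ExtTensor B C E G) :=
  (Submodule.isClosed_topologicalClosure _).completeSpace_coe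

/-- A continuous linear map that sends the elementary tensors into a closed subspace sends `E ⊗ G`
into it. -/
lemma extTensor_map_mem {V : Type*} [NormedAddCommGroup V] [NormedSpace ℂ V]
    (f : ModBlocks B C E G →L[ℂ] V) (W : Submodule ℂ V) (hW : IsClosed (W : Set V))
    (h : ∀ e g, f (modTmul e g) ∈ W) {T : ModBlocks B C E G} (hT : T ∈ extTensor B C E G) :
    f T ∈ W := by
  have : extTensor B C E G ≤ W.comap (f : ModBlocks B C E G →ₗ[ℂ] V) := by
    refine Submodule.topologicalClosure_minimal _ ?_ (hW.preimage f.continuous)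
    rw [Submodule.span_le]
    rintro _ ⟨p, rfl⟩
    exact h p.1 p.2
  exact this hT

lemma modInner_mem {S T : ModBlocks B C E G} (hS : S ∈ extTensor B C E G)
    (hT : T ∈ extTensor B C E G) : modInner S T ∈ minTensor B C := by
  have hcl : IsClosed ((minTensor B C).toSubmodule : Set (Blocks B C)) :=
    NonUnitalStarSubalgebra.isClosed_topologicalClosure _
  have h1 : ∀ (e : E) (g : G) {T : ModBlocks B C E G}, T ∈ extTensor B C E G →
      modInner (modTmul e g) T ∈ minTensor B C := fun e g T hT =>
    extTensor_map_mem (modInnerR (modTmul e g)) (minTensor B C).toSubmodule hcl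
      (fun e' g' => by
        change modInner _ _ ∈ minTensor B C
        rw [modInner_tmul]
        exact (algTmul _ _).2) hT
  rw [← star_modInner]
  refine star_mem ?_
  exact extTensor_map_mem (modInnerR T) (minTensor B C).toSubmodule hcl
    (fun e g => by
      change modInner _ _ ∈ minTensor B C
      rw [← star_modInner]
      exact star_mem (h1 e g hT)) hS

lemma modAct_mem {T : ModBlocks B C E G} {d : Blocks B C} (hT : T ∈ extTensor B C E G)
    (hd : d ∈ minTensor B C) : modAct T d ∈ extTensor B C E G := by
  have hcl : IsClosed (extTensor B C E G : Set (ModBlocks B C E G)) :=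
    Submodule.isClosed_topologicalClosure _
  have h0 : ∀ (b : B) (c : C), ∀ T ∈ extTensor B C E G,
      modAct T (blockTmul b c) ∈ extTensor B C E G := fun b c T hT =>
    extTensor_map_mem (modActL (blockTmul b c)) _ hcl
      (fun e g => by
        change modAct _ _ ∈ extTensor B C E G
        rw [modAct_tmul]
        exact modTmul_mem _ _) hT
  have h1 : ∀ d ∈ NonUnitalStarAlgebra.adjoin ℂ
      (Set.range fun p : B × C => blockTmul p.1 p.2), ∀ T ∈ extTensor B C E G,
      modAct T d ∈ extTensor B C E G := by
    intro d hd
    change d ∈ NonUnitalAlgebra.adjoin ℂ _ at hd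
    induction hd using NonUnitalAlgebra.adjoin_induction with
    | mem d hd =>
      rcases hd with ⟨p, rfl⟩ | ⟨p, hp⟩
      · exact h0 p.1 p.2
      · have : d = blockTmul (star p.1) (star p.2) := by
          rw [← star_blockTmul, ← star_star d]; exact congrArg star hp.symm
        rw [this]
        exact h0 _ _
    | add d d' _ _ h h' =>
      intro T hT
      change modActR T (d + d') ∈ _
      rw [map_add]
      exact add_mem (h T hT) (h' T hT)
    | zero =>
      intro T hT
      change modActR T 0 ∈ _
      rw [map_zero]
      exact zero_mem _
    | mul d d' _ _ h h' => exact fun T hT => h' _ (h T hT)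
    | smul z d _ h =>
      intro T hT
      change modActR T (z • d) ∈ _
      rw [map_smul]
      exact Submodule.smul_mem _ _ (h T hT)
  have h2 : (minTensor B C : Set (Blocks B C)) ⊆ modActR T ⁻¹' (extTensor B C E G) := by
    refine closure_minimal ?_ (hcl.preimage (modActR T).continuous)
    exact fun d hd => h1 d hd T hT
  exact h2 hd

/-- The right action of the minimal tensor product on `E ⊗ G`. -/
instance : SMul (MinTensor B C)ᵐᵒᵖ (ExtTensor B C E G) where
  smul d T := ⟨modAct T.1 (unop d).1, modAct_mem T.2 (unop d).2⟩

/-- The inner product of `E ⊗ G`, with values in the minimal tensor product. -/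
def extInner (S T : ExtTensor B C E G) : MinTensor B C :=
  ⟨modInner S.1 T.1, modInner_mem S.2 T.2⟩

lemma eq_zero_of_sq_eq_neg_sq {x y : ℝ} (h : x ^ 2 = -y ^ 2) : y = 0 := by
  nlinarith [sq_nonneg x, sq_nonneg y]

lemma eq_zero_of_conj_modInner (T : ModBlocks B C E G) (n m : Blocks B C)
    (h : star n * modInner T T * n = -(star m * m)) : m = 0 := by
  refine Blocks.ext fun i => ContinuousLinearMap.ext fun ξ => ?_
  have h1 : (star n * modInner T T * n).at i ξ = (-(star m * m)).at i ξ := by rw [h]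
  rw [Blocks.mul_at, Blocks.mul_at, Blocks.neg_at, Blocks.mul_at, Blocks.star_at, Blocks.star_at,
    modInner_at] at h1
  have h2 := congrArg (fun η => ⟪ξ, η⟫_ℂ) h1
  simp only [ContinuousLinearMap.comp_apply, neg_apply, inner_neg_right,
    ContinuousLinearMap.adjoint_inner_right, inner_self_eq_norm_sq_to_K] at h2
  have h3 : ‖T.at i (n.at i ξ)‖ ^ 2 = -‖m.at i ξ‖ ^ 2 := by exact_mod_cast h2
  rw [Blocks.zero_at, zero_apply]
  exact norm_eq_zero.mp (eq_zero_of_sq_eq_neg_sq h3)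

/-- A self-adjoint `d` is positive if no compression `n⋆ d n` is negative and nonzero. -/
lemma nonneg_of_conj {D : Type*} [NonUnitalCStarAlgebra D] [PartialOrder D] [StarOrderedRing D]
    {d : D} (hsa : IsSelfAdjoint d)
    (h : ∀ n m : D, star n * d * n = -(star m * m) → m = 0) : 0 ≤ d := by
  have hn : 0 ≤ d⁻ := CFC.negPart_nonneg d
  obtain ⟨s, hs⟩ := CStarAlgebra.nonneg_iff_eq_star_mul_self.mp hn
  have hnsa : star d⁻ = d⁻ := (IsSelfAdjoint.of_nonneg hn).star_eq
  have h1 : d * d⁻ = -(d⁻ * d⁻) := by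
    have h0 : d * d⁻ = (d⁺ - d⁻) * d⁻ := by rw [CFC.posPart_sub_negPart d hsa]
    rw [h0, sub_mul, CFC.posPart_mul_negPart, zero_sub]
  have hz : s * d⁻ = 0 := h d⁻ (s * d⁻) (by
    rw [mul_assoc, h1, star_mul, hnsa, mul_assoc, ← mul_assoc (star s) s, ← hs, mul_neg])
  have h6 : d⁻ * d⁻ = 0 := by
    have h0 : d⁻ * d⁻ = star s * (s * d⁻) := by rw [← mul_assoc, ← hs]
    rw [h0, hz, mul_zero]
  have h7 : d⁻ = 0 := by
    rw [← CStarRing.star_mul_self_eq_zero_iff, hnsa, h6]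
  rw [← CFC.posPart_sub_negPart d hsa, h7, sub_zero]
  exact CFC.posPart_nonneg d

lemma extInner_self_nonneg (T : ExtTensor B C E G) : 0 ≤ extInner T T :=
  nonneg_of_conj (Subtype.ext (star_modInner T.1 T.1)) fun n m h =>
    Subtype.ext (eq_zero_of_conj_modInner T.1 n.1 m.1 (congrArg Subtype.val h))

lemma norm_extInner_self (T : ExtTensor B C E G) : ‖extInner T T‖ = ‖T‖ ^ 2 := by
  refine le_antisymm ((norm_modInner_le _ _).trans_eq (pow_two ‖T.1‖).symm) ?_
  have h : ‖T.1‖ ≤ √‖modInner T.1 T.1‖ := ModBlocks.norm_le (Real.sqrt_nonneg _) fun i => by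
    refine Real.le_sqrt_of_sq_le ?_
    rw [pow_two, ← ContinuousLinearMap.norm_adjoint_comp_self]
    exact (modInner T.1 T.1).norm_at_le i
  have h2 := pow_le_pow_left₀ (norm_nonneg _) h 2
  rwa [Real.sq_sqrt (norm_nonneg _)] at h2

/-- `E ⊗ G` is a (right) Hilbert module over the minimal tensor product of the algebras. -/
instance : CStarModule (MinTensor B C)ᵐᵒᵖ (ExtTensor B C E G) where
  inner S T := op (extInner S T)
  inner_add_right {S T U} := congrArg op (Subtype.ext ((modInnerR S.1).map_add T.1 U.1))
  inner_self_nonneg {T} := extInner_self_nonneg T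
  inner_self {T} := by
    rw [op_eq_zero_iff, ← norm_eq_zero, norm_extInner_self, sq_eq_zero_iff, norm_eq_zero]
  inner_op_smul_right {d S T} := unop_injective rfl
  inner_smul_right_complex {z S T} := congrArg op (Subtype.ext ((modInnerR S.1).map_smul z T.1))
  star_inner S T := congrArg op (Subtype.ext (star_modInner S.1 T.1))
  norm_eq_sqrt_norm_inner_self T := by
    rw [norm_op, norm_extInner_self, Real.sqrt_sq (norm_nonneg _)]

/-- The elementary tensor `e ⊗ g` in the exterior tensor product. -/
def tmul (e : E) (g : G) : ExtTensor B C E G := ⟨modTmul e g, modTmul_mem e g⟩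

lemma rinner_tmul (e e' : E) (g g' : G) :
    rinner (MinTensor B C) (tmul e g : ExtTensor B C E G) (tmul e' g') =
      algTmul (rinner B e e') (rinner C g g') :=
  Subtype.ext (modInner_tmul e e' g g')

lemma tmul_act (e : E) (g : G) (b : B) (c : C) :
    op (algTmul b c) • (tmul e g : ExtTensor B C E G) = tmul (op b • e) (op c • g) :=
  Subtype.ext (modAct_tmul e g b c)

end ExtTensor

/-! ### Correspondences, square integrable functions, and operator integrals -/

/-- A left action of the unital C⋆-algebra `A` on the Hilbert module `E` that makes `E` an
`A`-`B` correspondence: a unital star homomorphism from `A` into the adjointable operators on `E`,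
that is, a unital homomorphism into the bounded operators such that the operator of `star a` is
the adjoint of the operator of `a` for the `B`-valued inner product. -/
structure LeftAction (A B E : Type*) [CStarAlgebra A] [NonUnitalCStarAlgebra B] [PartialOrder B]
    [NormedAddCommGroup E] [NormedSpace ℂ E] [SMul Bᵐᵒᵖ E] [CStarModule Bᵐᵒᵖ E] where
  /-- The operator of an element of `A`. -/
  toAlgHom : A →ₐ[ℂ] (E →L[ℂ] E)
  /-- The operator of `star a` is the adjoint of the operator of `a`. -/
  rinner_apply_left (a : A) (e f : E) :
    rinner B (toAlgHom a e) f = rinner B e (toAlgHom (star a) f)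

/-- `F : X → E` is (strongly) measurable and `x ↦ ⟨F x | F x⟩` is Bochner integrable. -/
structure SqIntegrable (B : Type*) {X E : Type*} [NonUnitalCStarAlgebra B] [PartialOrder B]
    [NormedAddCommGroup E] [NormedSpace ℂ E] [SMul Bᵐᵒᵖ E] [CStarModule Bᵐᵒᵖ E]
    [MeasurableSpace X] (μ : Measure X) (F : X → E) : Prop where
  aestronglyMeasurable : AEStronglyMeasurable F μ
  integrable : Integrable (fun x => rinner B (F x) (F x)) μ

/-- The integral of the operators `T x` over `X` is the operator `S`, in the weak operator
topology of the Banach space `V`. -/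
def HasWeakOpIntegral {X V : Type*} [MeasurableSpace X] [NormedAddCommGroup V] [NormedSpace ℂ V]
    (μ : Measure X) (T : X → V → V) (S : V → V) : Prop :=
  ∀ (v : V) (Λ : V →L[ℂ] ℂ),
    Integrable (fun x => Λ (T x v)) μ ∧ ∫ x, Λ (T x v) ∂μ = Λ (S v)

/-- The series `∑ u k` over the indices `k = 0, 1, 2, …` with `k < N`, where `N` is finite or
infinite, converges to `s` in norm. -/
def HasSeriesSum {V : Type*} [NormedAddCommGroup V] (N : ℕ∞) (u : ℕ → V) (s : V) : Prop :=
  Tendsto (fun n : ℕ => ∑ k ∈ (Finset.range n).filter (fun k : ℕ => (k : ℕ∞) < N), u k) atTop (𝓝 s)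

end HilbertMod

end

/-! Weak operator integrals over a Hilbert module are reduced to Hilbert space integrals, where the
claim becomes a Parseval identity. A bounded functional `Λ` on a Hilbert module need not have the
form `⟨h₀ | ·⟩`, but by Hahn-Banach some positive functional `ψ` on the coefficient algebra
satisfies `|Λ h|² ≤ ψ⟨h | h⟩` (`exists_positive_norm_sq_le`). So `Λ` is a vector functional `⟪ξ, ·⟫`
on the Hilbert space `Loc ψ H`, and `Λ(|e⟩⟨f| h) = ⟪θ(e)† ξ, θ(f)† h⟫`.

With `T k x = θ(u k x)†`, where `u k x` is the `k`-th term of the coherent state, the terms are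
orthogonal in the mean: for an elementary tensor `h = e ⊗ g`, the functions `T k · h'` and `T l · h`
have `L²` inner product `δ_{kl} ⟪h', r k⟫`, with `r k = e ⊗ |φ k⟩⟨φ k| g` and `∑ r k = h`. This
follows from `|a F k⟩⟨a F l| = a |F k⟩⟨F l| a⋆` and `a a⋆ = 1`.

Hence `∑ T k · h` is an orthogonal series in `L²` whose squared norms sum to `‖h‖²`. It converges in
`L²`, and its limit is a.e. the pointwise sum `T' x h`. So `h ↦ T' · h` is isometric on a dense
subspace; it extends to all of `Loc ψ H`, and the extension is still given by `T' x` a.e.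
(`integral_inner_eq_of_hasOrthExpansion`). Polarised, this is the asserted integral. No domination
of the partial sums, uniform in `x`, is needed. -/

noncomputable section

namespace HilbertMod

/-! ### Operator families that are orthogonal in the mean -/

section Frame

variable {X K L : Type*} [MeasurableSpace X] {μ : Measure X} [NormedAddCommGroup L]

/-- The limit in `Lp` of a pointwise convergent sequence is the pointwise limit. -/
lemma ae_eq_of_tendsto_Lp {f : ℕ → Lp L 2 μ} {F : ℕ → X → L} {g : Lp L 2 μ} {G : X → L}
    (hf : Tendsto f atTop (𝓝 g)) (hfF : ∀ n, f n =ᵐ[μ] F n)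
    (hF : ∀ x, Tendsto (fun n => F n x) atTop (𝓝 (G x))) : g =ᵐ[μ] G := by
  -- A subsequence converges a.e., and along it the pointwise limit is still `G x`.
  obtain ⟨ns, hns, h⟩ := (tendstoInMeasure_of_tendsto_Lp hf).exists_seq_tendsto_ae
  filter_upwards [h, ae_all_iff.mpr hfF] with x hx hx2
  refine tendsto_nhds_unique hx ?_
  simp only [hx2]
  exact (hF x).comp hns.tendsto_atTop

variable [InnerProductSpace ℂ L] [NormedAddCommGroup K] [InnerProductSpace ℂ K]

/-- A family of vectors in a Hilbert space whose pairwise inner products are those of an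
orthogonal family with summable square norms is summable. -/
lemma summable_of_inner_eq_ite [CompleteSpace L] {g : ℕ → L} {a : ℕ → ℝ} {c : ℝ}
    (hg : ∀ k l, ⟪g k, g l⟫_ℂ = if k = l then (a k : ℂ) else 0)
    (ha : Tendsto (fun n => ∑ k ∈ Finset.range n, a k) atTop (𝓝 c)) : Summable g := by
  have hnorm : ∀ J : Finset ℕ, ‖∑ k ∈ J, g k‖ ^ 2 = ∑ k ∈ J, a k := by
    intro J
    have h : ((‖∑ k ∈ J, g k‖ ^ 2 : ℝ) : ℂ) = ((∑ k ∈ J, a k : ℝ) : ℂ) := by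
      rw [Complex.ofReal_pow, ← RCLike.ofReal_eq_complex_ofReal,
        ← inner_self_eq_norm_sq_to_K (𝕜 := ℂ), sum_inner]
      simp only [inner_sum, hg, Finset.sum_ite_eq]
      rw [Finset.sum_ite_mem, Finset.inter_self]
      push_cast
      rfl
    exact_mod_cast h
  -- Singletons in `hnorm` give `a k = ‖g k‖²`, so convergent partial sums mean summability.
  have ha0 : ∀ k, 0 ≤ a k := fun k => by
    rw [← Finset.sum_singleton a k, ← hnorm]; positivity
  have hs : Summable a := ((hasSum_iff_tendsto_nat_of_nonneg ha0 c).mpr ha).summable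
  rw [summable_iff_vanishing_norm] at hs ⊢
  intro ε hε
  obtain ⟨s, hs⟩ := hs (ε ^ 2) (by positivity)
  refine ⟨s, fun t ht => ?_⟩
  have h := hs t ht
  rw [← hnorm, Real.norm_of_nonneg (by positivity)] at h
  exact lt_of_pow_lt_pow_left₀ 2 hε.le h

/-- `h` has an expansion `∑ r k` along which the operators `T k x` are orthogonal in the mean,
tested against the vectors of `S`. -/
def HasOrthExpansion (μ : Measure X) (T : ℕ → X → K →L[ℂ] L) (S : Set K) (h : K) : Prop :=
  ∃ r : ℕ → K, Tendsto (fun n => ∑ k ∈ Finset.range n, r k) atTop (𝓝 h) ∧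
    ∀ h' ∈ S, ∀ k l, Integrable (fun x => ⟪T k x h', T l x h⟫_ℂ) μ ∧
      ∫ x, ⟪T k x h', T l x h⟫_ℂ ∂μ = if k = l then ⟪h', r k⟫_ℂ else 0

/-- The expansion `r` must not depend on the test vector. So linearity in `h` comes first, with `S`
still the test set, and conjugate linearity in `h'` second, with `r` fixed. -/
lemma HasOrthExpansion.span {T : ℕ → X → K →L[ℂ] L} {S : Set K}
    (hS : ∀ h ∈ S, HasOrthExpansion μ T S h) {h : K} (hh : h ∈ Submodule.span ℂ S) :
    HasOrthExpansion μ T (Submodule.span ℂ S) h := by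
  have h1 : HasOrthExpansion μ T S h := by
    induction hh using Submodule.span_induction with
    | mem h hh => exact hS h hh
    | zero => exact ⟨0, by simp, by simp⟩
    | add h₁ h₂ _ _ ih₁ ih₂ =>
      obtain ⟨r₁, hr₁, hi₁⟩ := ih₁
      obtain ⟨r₂, hr₂, hi₂⟩ := ih₂
      refine ⟨r₁ + r₂, by simpa [Finset.sum_add_distrib] using hr₁.add hr₂, fun h' hh' k l => ?_⟩
      have e₁ := hi₁ h' hh' k l
      have e₂ := hi₂ h' hh' k l
      simp only [map_add, inner_add_right, Pi.add_apply]
      refine ⟨e₁.1.add e₂.1, ?_⟩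
      rw [integral_add e₁.1 e₂.1, e₁.2, e₂.2]
      split_ifs <;> simp
    | smul z h _ ih =>
      obtain ⟨r, hr, hi⟩ := ih
      refine ⟨z • r, by simpa [Finset.smul_sum] using hr.const_smul z, fun h' hh' k l => ?_⟩
      have e := hi h' hh' k l
      simp only [map_smul, inner_smul_right, Pi.smul_apply]
      refine ⟨e.1.const_mul z, ?_⟩
      rw [integral_const_mul, e.2]
      split_ifs <;> simp
  obtain ⟨r, hr, hi⟩ := h1
  refine ⟨r, hr, fun h' hh' k l => ?_⟩
  induction hh' using Submodule.span_induction with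
  | mem h' hh' => exact hi h' hh' k l
  | zero => simp
  | add h₁ h₂ _ _ ih₁ ih₂ =>
    simp only [map_add, inner_add_left]
    refine ⟨ih₁.1.add ih₂.1, ?_⟩
    rw [integral_add ih₁.1 ih₂.1, ih₁.2, ih₂.2]
    split_ifs <;> simp
  | smul z h' _ ih =>
    simp only [map_smul, inner_smul_left]
    refine ⟨ih.1.const_mul _, ?_⟩
    rw [integral_const_mul, ih.2]
    split_ifs <;> simp

/-- The partial sums of an orthogonal expansion converge in the mean square. -/
lemma HasOrthExpansion.exists_hasSum [CompleteSpace L] {T : ℕ → X → K →L[ℂ] L}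
    (hT : ∀ k ξ, AEStronglyMeasurable (fun x => T k x ξ) μ)
    {T' : X → K →L[ℂ] L}
    (hT' : ∀ x ξ, Tendsto (fun n => ∑ k ∈ Finset.range n, T k x ξ) atTop (𝓝 (T' x ξ)))
    {P : Submodule ℂ K} (hP : ∀ h ∈ P, HasOrthExpansion μ T P h) {h : K} (hh : h ∈ P) :
    ∃ hm : ∀ k, MemLp (fun x => T k x h) 2 μ, ∃ hm' : MemLp (fun x => T' x h) 2 μ,
      HasSum (fun k => (hm k).toLp) hm'.toLp := by
  obtain ⟨r, hr, hi⟩ := hP h hh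
  have hm : ∀ k, MemLp (fun x => T k x h) 2 μ := fun k => by
    rw [memLp_two_iff_integrable_sq_norm (hT k h)]
    -- The diagonal case `h' = h`, `k = l` is integrability of the squared norm.
    have h1 := (hi h hh k k).1.re
    simpa only [inner_self_eq_norm_sq] using h1
  -- On the diagonal `⟪h, r k⟫` is a squared norm, hence real, and nothing is lost in taking its
  -- real part.
  have hg : ∀ k l, ⟪(hm k).toLp, (hm l).toLp⟫_ℂ =
      if k = l then (((⟪h, r k⟫_ℂ).re : ℝ) : ℂ) else 0 := by
    intro k l
    have h1 : ⟪(hm k).toLp, (hm l).toLp⟫_ℂ = if k = l then ⟪h, r k⟫_ℂ else 0 := by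
      rw [L2.inner_def, ← (hi h hh k l).2]
      refine integral_congr_ae ?_
      filter_upwards [(hm k).coeFn_toLp, (hm l).coeFn_toLp] with x h1 h2
      rw [h1, h2]
    rw [h1]
    split_ifs with hkl
    · subst hkl
      rw [if_pos rfl] at h1
      rw [← h1, inner_self_eq_norm_sq_to_K]
      norm_cast
    · rfl
  have ha : Tendsto (fun n => ∑ k ∈ Finset.range n, (⟪h, r k⟫_ℂ).re) atTop
      (𝓝 (⟪h, h⟫_ℂ).re) := by
    have h1 := (Complex.continuous_re.tendsto _).comp
      ((tendsto_const_nhds (x := h)).inner (𝕜 := ℂ) hr)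
    simpa only [Function.comp_def, inner_sum, Complex.re_sum] using h1
  obtain ⟨g, hgs⟩ := summable_of_inner_eq_ite hg ha
  have hlim : g =ᵐ[μ] fun x => T' x h := by
    refine ae_eq_of_tendsto_Lp hgs.tendsto_sum_nat
      (F := fun n x => ∑ k ∈ Finset.range n, T k x h) (fun n => ?_) fun x => hT' x h
    filter_upwards [Lp.coeFn_finsetSum (Finset.range n) fun k => (hm k).toLp,
      ae_all_iff.mpr fun k => (hm k).coeFn_toLp] with x hx hx2
    rw [hx, Finset.sum_apply]
    exact Finset.sum_congr rfl fun k _ => hx2 k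
  have hm' : MemLp (fun x => T' x h) 2 μ := (memLp_congr_ae hlim).mp (Lp.memLp g)
  refine ⟨hm, hm', ?_⟩
  convert hgs
  exact Lp.ext (hm'.coeFn_toLp.trans hlim.symm)

/-- If the operators `T k x` are orthogonal in the mean on a total set of vectors, then their sum
`T' x` is isometric in the mean. -/
theorem integral_inner_eq_of_hasOrthExpansion [CompleteSpace K] [CompleteSpace L]
    {T : ℕ → X → K →L[ℂ] L}
    (hT : ∀ k ξ, AEStronglyMeasurable (fun x => T k x ξ) μ) {T' : X → K →L[ℂ] L}
    (hT' : ∀ x ξ, Tendsto (fun n => ∑ k ∈ Finset.range n, T k x ξ) atTop (𝓝 (T' x ξ)))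
    {S : Set K} (hSd : Dense (Submodule.span ℂ S : Set K))
    (hS : ∀ h ∈ S, HasOrthExpansion μ T S h) (ξ η : K) :
    Integrable (fun x => ⟪T' x ξ, T' x η⟫_ℂ) μ ∧ ∫ x, ⟪T' x ξ, T' x η⟫_ℂ ∂μ = ⟪ξ, η⟫_ℂ := by
  set P := Submodule.span ℂ S
  have hP : ∀ h ∈ P, HasOrthExpansion μ T P h := fun h hh => HasOrthExpansion.span hS hh
  choose hm hm' hsum using fun h : P => HasOrthExpansion.exists_hasSum hT hT' hP h.2
  have hinner : ∀ h' h : P, ⟪(hm' h').toLp, (hm' h).toLp⟫_ℂ = ⟪(h' : K), (h : K)⟫_ℂ := by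
    intro h' h
    obtain ⟨r, hr, hi⟩ := hP h h.2
    -- Both series are cut at the same `n`; orthogonality collapses the double sum to `∑_{k<n} ⟪h',
    -- r k⟫`, which tends to `⟪h', h⟫`.
    have h1 := (hsum h').tendsto_sum_nat.inner (𝕜 := ℂ) (hsum h).tendsto_sum_nat
    have h2 := (tendsto_const_nhds (x := (h' : K))).inner (𝕜 := ℂ) hr
    refine tendsto_nhds_unique h1 (h2.congr fun n => ?_)
    rw [sum_inner, inner_sum]
    refine Finset.sum_congr rfl fun k hk => ?_
    have h3 : ∀ l, ⟪(hm h' k).toLp, (hm h l).toLp⟫_ℂ = if k = l then ⟪(h' : K), r k⟫_ℂ else 0 := by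
      intro l
      rw [L2.inner_def, ← (hi h' h'.2 k l).2]
      refine integral_congr_ae ?_
      filter_upwards [(hm h' k).coeFn_toLp, (hm h l).coeFn_toLp] with x h1 h2
      rw [h1, h2]
    rw [inner_sum]
    simp only [h3]
    rw [Finset.sum_ite_eq, if_pos hk]
  let W₀ : P →ₗ[ℂ] Lp L 2 μ :=
    { toFun := fun h => (hm' h).toLp
      map_add' := fun h h' => by
        rw [← MemLp.toLp_add]
        exact MemLp.toLp_congr _ _ (ae_of_all _ fun x => map_add (T' x) (h : K) h')
      map_smul' := fun z h => by
        rw [RingHom.id_apply, ← MemLp.toLp_const_smul]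
        exact MemLp.toLp_congr _ _ (ae_of_all _ fun x => map_smul (T' x) z (h : K)) }
  have hnorm : ∀ h : P, ‖W₀ h‖ = ‖(h : K)‖ := fun h => by
    rw [@norm_eq_sqrt_re_inner ℂ, @norm_eq_sqrt_re_inner ℂ K]
    exact congrArg (fun z : ℂ => √z.re) (hinner h h)
  let W : K →L[ℂ] Lp L 2 μ := W₀.extendOfNorm P.subtype
  have hPd : DenseRange P.subtype := by
    rw [DenseRange, Submodule.coe_subtype, Subtype.range_coe]; exact hSd
  have hW : ∀ h : P, W h = (hm' h).toLp := fun h =>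
    LinearMap.extendOfNorm_eq hPd ⟨1, fun h => by rw [hnorm h, one_mul]; rfl⟩ h
  -- Approximants from `P` converge in `L²` because `W` is continuous, and at each `x` because `T'
  -- x` is; the two limits agree a.e.
  have hWae : ∀ ξ, W ξ =ᵐ[μ] fun x => T' x ξ := by
    intro ξ
    obtain ⟨p, hp, hpξ⟩ := mem_closure_iff_seq_limit.mp (hSd ξ)
    refine ae_eq_of_tendsto_Lp (f := fun n => W (p n)) (F := fun n x => T' x (p n))
      ((W.continuous.tendsto ξ).comp hpξ) (fun n => ?_)
      (fun x => ((T' x).continuous.tendsto ξ).comp hpξ)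
    have h := hW ⟨p n, hp n⟩
    simp only at h
    rw [h]
    exact (hm' ⟨p n, hp n⟩).coeFn_toLp
  have hWi : ∀ ξ η, ⟪W ξ, W η⟫_ℂ = ⟪ξ, η⟫_ℂ := by
    intro ξ η
    refine hPd.induction_on₂ (p := fun ξ η => ⟪W ξ, W η⟫_ℂ = ⟪ξ, η⟫_ℂ) ?_ (fun h h' => ?_) ξ η
    · apply isClosed_eq <;> fun_prop
    · simp only [Submodule.subtype_apply]
      rw [hW, hW, hinner]
  have hae : (fun x => ⟪W ξ x, W η x⟫_ℂ) =ᵐ[μ] fun x => ⟪T' x ξ, T' x η⟫_ℂ := by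
    filter_upwards [hWae ξ, hWae η] with x h1 h2
    rw [h1, h2]
  exact ⟨(L2.integrable_inner (𝕜 := ℂ) (W ξ) (W η)).congr hae,
    by rw [← integral_congr_ae hae, ← L2.inner_def, hWi]⟩

end Frame

/-! ### Domination of bounded functionals by positive functionals -/

section Functional

variable {D H : Type*} [NonUnitalCStarAlgebra D] [PartialOrder D]
  [NormedAddCommGroup H] [NormedSpace ℂ H] [SMul Dᵐᵒᵖ H] [CStarModule Dᵐᵒᵖ H]

lemma rinner_sum_left {ι : Type*} (s : Finset ι) (e : ι → H) (f : H) :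
    rinner D (∑ i ∈ s, e i) f = ∑ i ∈ s, rinner D (e i) f := by
  simp [rinner, CStarModule.inner_sum_left]

lemma rinner_sum_right {ι : Type*} (s : Finset ι) (e : H) (f : ι → H) :
    rinner D e (∑ i ∈ s, f i) = ∑ i ∈ s, rinner D e (f i) := by
  simp [rinner, CStarModule.inner_sum_right]

lemma rinner_sub_left (e f g : H) : rinner D (e - f) g = rinner D e g - rinner D f g := by
  simp [rinner]

lemma rinner_sub_right (e f g : H) : rinner D e (f - g) = rinner D e f - rinner D e g := by
  simp [rinner]

variable [StarOrderedRing D]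

/-- The Cauchy-Schwarz inequality for convex combinations. -/
lemma rinner_sum_smul_le {ι : Type*} [Fintype ι] {w : ι → ℝ} (hw : ∀ i, 0 ≤ w i)
    (hw1 : ∑ i, w i = 1) (h : ι → H) :
    rinner D (∑ i, (w i : ℂ) • h i) (∑ i, (w i : ℂ) • h i) ≤
      ∑ i, (w i : ℂ) • rinner D (h i) (h i) := by
  set v := ∑ i, (w i : ℂ) • h i with hv
  have hw1' : ∑ i, (w i : ℂ) = 1 := by exact_mod_cast hw1
  -- The variance about the mean `v` is positive; expanding it gives the claim.
  have h1 : 0 ≤ ∑ i, (w i : ℂ) • rinner D (h i - v) (h i - v) :=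
    Finset.sum_nonneg fun i _ => smul_nonneg (by exact_mod_cast hw i) (rinner_self_nonneg _)
  have h2 : ∑ i, (w i : ℂ) • rinner D (h i) v = rinner D v v := by
    conv_rhs => rw [hv, rinner_sum_left, ← hv]
    exact Finset.sum_congr rfl fun i _ => by rw [rinner_smul_left]; simp
  have h3 : ∑ i, (w i : ℂ) • rinner D v (h i) = rinner D v v := by
    conv_rhs => rw [hv, rinner_sum_right, ← hv]
    exact Finset.sum_congr rfl fun i _ => by rw [rinner_smul_right]
  simp only [rinner_sub_left, rinner_sub_right, smul_sub, Finset.sum_sub_distrib, h2, h3,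
    ← Finset.sum_smul, hw1', one_smul, sub_self, sub_zero] at h1
  exact sub_nonneg.mp h1

/-- A bounded functional that is at least one on `M` stays away from zero on the convex hull. -/
lemma one_le_of_mem_convexHull (Λ : H →L[ℂ] ℂ) {d p : D}
    (hd : d ∈ convexHull ℝ {d : D | ∃ h : H, Λ h = 1 ∧ rinner D h h = d}) (hp : 0 ≤ p) :
    1 ≤ ‖Λ‖ ^ 2 * ‖d + p‖ := by
  obtain ⟨ι, _, w, z, hw, hw1, hz, rfl⟩ := mem_convexHull_iff_exists_fintype.mp hd
  choose h hΛ hzh using hz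
  have h1 := rinner_sum_smul_le (D := D) hw hw1 h
  set v := ∑ i, (w i : ℂ) • h i
  have hv : Λ v = 1 := by
    simp only [v, map_sum, map_smul, hΛ, smul_eq_mul, mul_one]
    exact_mod_cast hw1
  have h2 : rinner D v v ≤ ∑ i, w i • z i + p := by
    refine (h1.trans_eq ?_).trans (le_add_of_nonneg_right hp)
    exact Finset.sum_congr rfl fun i _ => by rw [hzh, Complex.coe_smul]
  have h3 := CStarAlgebra.norm_le_norm_of_nonneg_of_le (rinner_self_nonneg v) h2
  rw [norm_rinner_self] at h3
  have h4 := Λ.le_opNorm v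
  rw [hv, norm_one] at h4
  calc (1 : ℝ) ≤ (‖Λ‖ * ‖v‖) ^ 2 := one_le_pow₀ h4
    _ = ‖Λ‖ ^ 2 * ‖v‖ ^ 2 := mul_pow _ _ _
    _ ≤ _ := by gcongr

/-- The positive functional with the values of `f` on the positive elements. -/
def positiveOfReal (f : StrongDual ℝ D) (hf : ∀ d, 0 ≤ d → 0 ≤ f d) : D →ₚ[ℂ] ℂ :=
  PositiveLinearMap.mk₀
    (Module.Dual.extendRCLike
      -- Adding `f ∘ star` makes the complexification real on self-adjoint `d`: its imaginary part
      -- comes from `f (i d) + f (-i d) = 0`, and its value is `2 f d`.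
      (f.toLinearMap + f.toLinearMap ∘ₗ (starLinearEquiv ℝ (A := D)).toLinearMap))
    fun d hd => by
      have hs : star d = d := (IsSelfAdjoint.of_nonneg hd).star_eq
      rw [Module.Dual.extendRCLike_apply]
      simp only [LinearMap.add_apply, LinearMap.comp_apply, LinearEquiv.coe_coe,
        starLinearEquiv_apply, star_smul, hs, ContinuousLinearMap.coe_coe]
      have := hf d hd
      simp
      positivity

lemma re_positiveOfReal {f : StrongDual ℝ D} (hf : ∀ d, 0 ≤ d → 0 ≤ f d) {d : D} (hd : 0 ≤ d) :
    (positiveOfReal f hf d).re = 2 * f d := by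
  have hs : star d = d := (IsSelfAdjoint.of_nonneg hd).star_eq
  have h := Module.Dual.re_extendRCLike_apply (𝕜 := ℂ)
    (f.toLinearMap + f.toLinearMap ∘ₗ (starLinearEquiv ℝ (A := D)).toLinearMap) d
  refine h.trans ?_
  simp only [LinearMap.add_apply, LinearMap.comp_apply, LinearEquiv.coe_coe,
        starLinearEquiv_apply, hs, ContinuousLinearMap.coe_coe]
  ring

open scoped Pointwise in
/-- A bounded functional on a Hilbert module is bounded in the scalar inner product of some
positive functional. -/
theorem exists_positive_norm_sq_le (Λ : H →L[ℂ] ℂ) :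
    ∃ ψ : D →ₚ[ℂ] ℂ, ∀ h, ‖Λ h‖ ^ 2 ≤ (ψ (rinner D h h)).re := by
  by_cases hΛ : Λ = 0
  · exact ⟨0, fun h => by simp [hΛ]⟩
  obtain ⟨h₀, hh₀⟩ : ∃ h, Λ h ≠ 0 := by
    by_contra! h
    exact hΛ (ContinuousLinearMap.ext h)
  set Q : Set D := {d : D | ∃ h : H, Λ h = 1 ∧ rinner D h h = d}
  have hnormal : ∀ h, Λ h ≠ 0 → rinner D ((Λ h)⁻¹ • h) ((Λ h)⁻¹ • h) ∈ Q := fun h hh =>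
    ⟨_, by rw [map_smul, smul_eq_mul, inv_mul_cancel₀ hh], rfl⟩
  -- The summand `Set.Ici 0` forces a separating functional to be nonnegative on positive elements.
  let t : Set D := convexHull ℝ Q + Set.Ici 0
  have hpos : 0 < ‖Λ‖ ^ 2 := by have := norm_pos_iff.mpr hΛ; positivity
  have hdisj : Disjoint (Metric.ball (0 : D) (1 / ‖Λ‖ ^ 2)) t := by
    rw [Set.disjoint_left]
    rintro _ hb ⟨d, hd, p, hp, rfl⟩
    have h1 := one_le_of_mem_convexHull Λ hd hp
    rw [mem_ball_zero_iff, lt_div_iff₀ hpos] at hb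
    simp only at hb
    linarith
  obtain ⟨f, u, hfb, hft⟩ := geometric_hahn_banach_open (convex_ball (0 : D) (1 / ‖Λ‖ ^ 2))
    Metric.isOpen_ball ((convex_convexHull ℝ Q).add (convex_Ici (0 : D))) hdisj
  have hu : 0 < u := by simpa using hfb 0 (Metric.mem_ball_self (by positivity))
  have hfQ : ∀ d ∈ Q, ∀ p, 0 ≤ p → u ≤ f d + f p := fun d hd p hp => by
    rw [← map_add]
    exact hft _ ⟨d, subset_convexHull ℝ Q hd, p, hp, rfl⟩
  have hf : ∀ d, 0 ≤ d → 0 ≤ f d := by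
    intro p hp
    by_contra! hneg
    set q := f (rinner D ((Λ h₀)⁻¹ • h₀) ((Λ h₀)⁻¹ • h₀))
    -- If `f p < 0`, this multiple of `p` contributes `-|q|`, so that `u ≤ q - |q| ≤ 0`, against `0
    -- < u`.
    have h1 := hfQ _ (hnormal h₀ hh₀) ((|q| / -(f p)) • p)
      (smul_nonneg (div_nonneg (abs_nonneg _) (by linarith)) hp)
    rw [map_smul, smul_eq_mul, div_neg, neg_mul, div_mul_cancel₀ _ hneg.ne] at h1
    have := le_abs_self q
    linarith
  have hfu : ∀ d, 0 ≤ d → 0 ≤ (u⁻¹ • f) d := fun d hd =>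
    mul_nonneg (inv_nonneg.mpr hu.le) (hf d hd)
  refine ⟨positiveOfReal (u⁻¹ • f) hfu, fun h => ?_⟩
  have hd := rinner_self_nonneg (B := D) h
  rw [re_positiveOfReal _ hd]
  have hd' := hfu _ hd
  by_cases hh : Λ h = 0
  · rw [hh]; simpa using hd'
  have h1 := hfQ _ (hnormal h hh) 0 le_rfl
  have h2 : rinner D ((Λ h)⁻¹ • h) ((Λ h)⁻¹ • h) = ((‖Λ h‖ ^ 2)⁻¹ : ℝ) • rinner D h h := by
    rw [rinner_smul_left, rinner_smul_right, smul_smul, ← Complex.coe_smul]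
    congr 1
    rw [Complex.star_def, Complex.conj_mul', norm_inv]
    push_cast
    rw [inv_pow]
  rw [h2, map_smul, map_zero, add_zero, smul_eq_mul, inv_mul_eq_div, le_div_iff₀ (by positivity)]
    at h1
  have h3 : ‖Λ h‖ ^ 2 ≤ (u⁻¹ • f) (rinner D h h) := by
    change _ ≤ u⁻¹ * _
    rw [inv_mul_eq_div, le_div_iff₀ hu, mul_comm]
    exact h1
  -- The bound holds with room to spare: symmetrisation doubled the functional.
  linarith

/-- A bounded functional on a Hilbert module is a vector functional in some localisation. -/
theorem exists_eq_inner_toPreLoc (Λ : H →L[ℂ] ℂ) :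
    ∃ (ψ : D →ₚ[ℂ] ℂ) (ξ : Loc ψ H), ∀ h, Λ h = ⟪ξ, (toPreLoc ψ H h : Loc ψ H)⟫_ℂ := by
  obtain ⟨ψ, hψ⟩ := exists_positive_norm_sq_le (D := D) Λ
  let Λ₀ : PreLoc ψ H →ₗ[ℂ] ℂ := Λ.toLinearMap ∘ₗ (ofPreLoc ψ H).toLinearMap
  have hb : ∀ h, ‖Λ₀ h‖ ≤ 1 * ‖h‖ := fun h => by
    rw [one_mul, ← sq_le_sq₀ (norm_nonneg _) (norm_nonneg _)]
    refine (hψ (ofPreLoc ψ H h)).trans_eq ?_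
    rw [← preLoc_norm_sq ψ (ofPreLoc ψ H h), Complex.ofReal_re]
    rfl
  let Λ₁ : Loc ψ H →L[ℂ] ℂ := (Λ₀.mkContinuous 1 hb).extend (Completion.toComplL (𝕜 := ℂ))
  refine ⟨ψ, (InnerProductSpace.toDual ℂ _).symm Λ₁, fun h => ?_⟩
  rw [InnerProductSpace.toDual_symm_apply]
  exact ((Λ₀.mkContinuous 1 hb).extend_eq Completion.denseRange_coe
    (Completion.isUniformInducing_coe _) (toPreLoc ψ H h)).symm

end Functional

/-! ### Rank one operators in a localisation -/

section LocMaps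

variable {D H : Type*} [NonUnitalCStarAlgebra D] [PartialOrder D] [StarOrderedRing D]
  [NormedAddCommGroup H] [NormedSpace ℂ H] [SMul Dᵐᵒᵖ H] [CStarModule Dᵐᵒᵖ H]

/-- The canonical map into the localisation. -/
def toLoc (ψ : D →ₚ[ℂ] ℂ) : H →L[ℂ] Loc ψ H :=
  LinearMap.mkContinuousOfExistsBound
    ((Completion.toComplL (𝕜 := ℂ)).toLinearMap ∘ₗ (toPreLoc ψ H).toLinearMap) (by
      obtain ⟨C, hC⟩ := ψ.exists_norm_apply_le
      refine ⟨√(C : ℝ), fun h => ?_⟩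
      change ‖(toPreLoc ψ H h : Loc ψ H)‖ ≤ _
      rw [Completion.norm_coe, ← sq_le_sq₀ (by positivity) (by positivity), mul_pow,
        Real.sq_sqrt (NNReal.coe_nonneg C)]
      have h1 := hC (rinner D h h)
      rw [← preLoc_norm_sq, norm_rinner_self, Complex.norm_real, norm_pow, norm_norm] at h1
      exact h1)

lemma toLoc_apply (ψ : D →ₚ[ℂ] ℂ) (h : H) : toLoc ψ h = (toPreLoc ψ H h : Loc ψ H) := rfl

lemma denseRange_toLoc (ψ : D →ₚ[ℂ] ℂ) : DenseRange (toLoc ψ : H → Loc ψ H) :=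
  Completion.denseRange_coe (α := PreLoc ψ H)

lemma θ_coe_eq_toLoc (ψ : D →ₚ[ℂ] ℂ) (e : H) (b : ψ.PreGNS) :
    θ ψ e (b : ψ.GNS) = toLoc ψ (op (ψ.ofPreGNS b) • e) := by
  rw [θ_coe, toLoc_apply]

lemma θ_add (ψ : D →ₚ[ℂ] ℂ) (e f : H) : θ ψ (e + f) = θ ψ e + θ ψ f := by
  ext x
  induction x using Completion.induction_on with
  | hp => apply isClosed_eq <;> fun_prop
  | ih b =>
    rw [add_apply, θ_coe_eq_toLoc, θ_coe_eq_toLoc, θ_coe_eq_toLoc, add_act, map_add]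

lemma θ_smul (ψ : D →ₚ[ℂ] ℂ) (z : ℂ) (e : H) : θ ψ (z • e) = z • θ ψ e := by
  ext x
  induction x using Completion.induction_on with
  | hp => exact isClosed_eq (θ ψ (z • e)).continuous (z • θ ψ e).continuous
  | ih b =>
    rw [smul_apply, θ_coe_eq_toLoc, θ_coe_eq_toLoc, smul_act e z (ψ.ofPreGNS b),
      map_smul (toLoc ψ)]

/-- The additive map `e ↦ θ e† ξ`. -/
def adjointθ (ψ : D →ₚ[ℂ] ℂ) (ξ : Loc ψ H) : H →+ ψ.GNS where
  toFun e := (θ ψ e).adjoint ξ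
  map_zero' := by
    have h := θ_smul ψ 0 (0 : H)
    rw [zero_smul, zero_smul] at h
    rw [h, map_zero, zero_apply]
  map_add' e f := by rw [θ_add, map_add, add_apply]

/-- Carries measurability and norm convergence from the module to the vectors `θ(e)† ξ`. -/
lemma continuous_adjointθ (ψ : D →ₚ[ℂ] ℂ) (ξ : Loc ψ H) : Continuous (adjointθ ψ ξ) :=
  AddMonoidHomClass.continuous_of_bound _ ‖ξ‖ fun e => by
    refine ((θ ψ e).adjoint.le_opNorm ξ).trans ?_
    rw [LinearIsometryEquiv.norm_map, mul_comm]
    exact mul_le_mul_of_nonneg_left (norm_θ_le ψ e) (norm_nonneg ξ)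

/-- The adjoint of `θ ψ e` plays the role of the bra `⟨e|`, because `⟨e b | h⟩ = b⋆ ⟨e | h⟩`. -/
lemma adjoint_θ_toLoc (ψ : D →ₚ[ℂ] ℂ) (e h : H) :
    (θ ψ e).adjoint (toLoc ψ h) = (ψ.toPreGNS (rinner D e h) : ψ.GNS) := by
  refine ext_inner_left ℂ fun y => ?_
  rw [ContinuousLinearMap.adjoint_inner_right]
  induction y using Completion.induction_on with
  | hp => apply isClosed_eq <;> fun_prop
  | ih b =>
    rw [θ_coe, toLoc_apply, Completion.inner_coe, Completion.inner_coe, preLoc_inner,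
      rinner_act_left, PositiveLinearMap.preGNS_inner_def]
    simp

/-- The operator `|e⟩⟨f|` in a localisation. -/
lemma inner_toLoc_ketBra (ψ : D →ₚ[ℂ] ℂ) (ξ : Loc ψ H) (e f h : H) :
    ⟪ξ, toLoc ψ (ketBra D e f h)⟫_ℂ = ⟪(θ ψ e).adjoint ξ, (θ ψ f).adjoint (toLoc ψ h)⟫_ℂ := by
  rw [ContinuousLinearMap.adjoint_inner_left, adjoint_θ_toLoc, θ_coe_eq_toLoc, ketBra,
    PositiveLinearMap.ofPreGNS_toPreGNS]

/-- If a pointwise convergent series `∑ u k x` is orthogonal in the mean, tested on a total set of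
vectors, then the operators `|s x⟩⟨s x|` given by its sum resolve the identity. -/
theorem hasWeakOpIntegral_ketBra_of_orthogonal {X : Type*} [MeasurableSpace X] {μ : Measure X}
    {u : ℕ → X → H} (hu : ∀ k, AEStronglyMeasurable (u k) μ) {s : X → H}
    (hs : ∀ x, Tendsto (fun n => ∑ k ∈ Finset.range n, u k x) atTop (𝓝 (s x)))
    {S : Set H} (hSd : Dense (Submodule.span ℂ S : Set H))
    (hS : ∀ h ∈ S, ∃ r : ℕ → H, Tendsto (fun n => ∑ k ∈ Finset.range n, r k) atTop (𝓝 h) ∧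
      ∀ k l, HasWeakOpIntegral μ (fun x _ => ketBra D (u k x) (u l x) h)
        (fun _ : H => if k = l then r k else 0)) :
    HasWeakOpIntegral μ (fun x => ketBra D (s x) (s x)) (fun h => h) := by
  intro h Λ
  obtain ⟨ψ, ξ, hξ⟩ := exists_eq_inner_toPreLoc (D := D) Λ
  have key := integral_inner_eq_of_hasOrthExpansion (μ := μ)
    (T := fun k x => (θ ψ (u k x)).adjoint) (T' := fun x => (θ ψ (s x)).adjoint)
    (fun k ξ => (continuous_adjointθ ψ ξ).comp_aestronglyMeasurable (hu k)) (fun x ξ => ?_)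
    (S := toLoc ψ '' S) ?_ ?_ ξ (toLoc ψ h)
  · simp only [← inner_toLoc_ketBra] at key
    simp only [hξ]
    exact key
  · refine (((continuous_adjointθ ψ ξ).tendsto _).comp (hs x)).congr fun n => ?_
    rw [Function.comp_apply, map_sum]
    rfl
  · have h1 := (denseRange_toLoc ψ).dense_image (toLoc ψ).continuous hSd
    have h2 := Submodule.map_span (toLoc ψ).toLinearMap S
    refine h1.mono ?_
    rw [show toLoc ψ '' S = (toLoc ψ).toLinearMap '' S from rfl, ← h2]
    exact subset_rfl
  · rintro _ ⟨h, hh, rfl⟩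
    obtain ⟨r, hr, hi⟩ := hS h hh
    refine ⟨fun k => toLoc ψ (r k), ?_, ?_⟩
    · refine (((toLoc ψ).continuous.tendsto _).comp hr).congr fun n => ?_
      simp only [Function.comp_apply, map_sum]
    · rintro _ ⟨h', -, rfl⟩ k l
      -- The operators in `hS` ignore their argument, so `0` is a dummy vector.
      have h1 := hi k l 0 (innerSL ℂ (toLoc ψ h') ∘L toLoc ψ)
      simp only [ContinuousLinearMap.comp_apply, innerSL_apply_apply, inner_toLoc_ketBra] at h1
      refine ⟨h1.1, h1.2.trans ?_⟩
      split_ifs <;> simp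

end LocMaps

/-! ### Bilinearity of the tensor product of operators -/

section OpTensor

variable {K₁ K₂ L₁ L₂ : Type*}
  [NormedAddCommGroup K₁] [InnerProductSpace ℂ K₁] [NormedAddCommGroup K₂] [InnerProductSpace ℂ K₂]
  [NormedAddCommGroup L₁] [InnerProductSpace ℂ L₁] [NormedAddCommGroup L₂] [InnerProductSpace ℂ L₂]

/-- The canonical map from the algebraic to the Hilbert space tensor product. -/
def HTensor.mk (t : K₁ ⊗[ℂ] K₂) : HTensor K₁ K₂ := (t : Completion (K₁ ⊗[ℂ] K₂))

lemma HTensor.denseRange_mk : DenseRange (HTensor.mk : K₁ ⊗[ℂ] K₂ → HTensor K₁ K₂) :=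
  Completion.denseRange_coe

lemma HTensor.mk_add (s t : K₁ ⊗[ℂ] K₂) : mk (s + t) = mk s + mk t := Completion.coe_add _ _

lemma HTensor.mk_smul (z : ℂ) (t : K₁ ⊗[ℂ] K₂) : mk (z • t) = z • mk t := Completion.coe_smul _ _

/-- Two operators on a Hilbert space tensor product are equal if they agree before completion. -/
lemma HTensor.op_ext {R R' : HTensor K₁ K₂ →L[ℂ] HTensor L₁ L₂} (h : ∀ t, R (mk t) = R' (mk t)) :
    R = R' :=
  ContinuousLinearMap.ext fun x => denseRange_mk.induction_on x
    (isClosed_eq R.continuous R'.continuous) h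

lemma opTensor_mk (S : K₁ →L[ℂ] L₁) (T : K₂ →L[ℂ] L₂) (t : K₁ ⊗[ℂ] K₂) :
    opTensor S T (HTensor.mk t) = HTensor.mk (TensorProduct.mapL S T t) :=
  ContinuousLinearMap.completion_apply_coe _ _

lemma opTensor_add_left (S S' : K₁ →L[ℂ] L₁) (T : K₂ →L[ℂ] L₂) :
    opTensor (S + S') T = opTensor S T + opTensor S' T :=
  HTensor.op_ext fun t => by
    rw [add_apply, opTensor_mk, opTensor_mk, opTensor_mk, TensorProduct.mapL_add_left,
      add_apply, HTensor.mk_add]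

lemma opTensor_add_right (S : K₁ →L[ℂ] L₁) (T T' : K₂ →L[ℂ] L₂) :
    opTensor S (T + T') = opTensor S T + opTensor S T' :=
  HTensor.op_ext fun t => by
    rw [add_apply, opTensor_mk, opTensor_mk, opTensor_mk, TensorProduct.mapL_add_right,
      add_apply, HTensor.mk_add]

lemma opTensor_smul_left (z : ℂ) (S : K₁ →L[ℂ] L₁) (T : K₂ →L[ℂ] L₂) :
    opTensor (z • S) T = z • opTensor S T :=
  HTensor.op_ext fun t => by
    rw [smul_apply, opTensor_mk, opTensor_mk, TensorProduct.mapL_smul_left,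
      smul_apply, HTensor.mk_smul]

lemma opTensor_smul_right (z : ℂ) (S : K₁ →L[ℂ] L₁) (T : K₂ →L[ℂ] L₂) :
    opTensor S (z • T) = z • opTensor S T :=
  HTensor.op_ext fun t => by
    rw [smul_apply, opTensor_mk, opTensor_mk, TensorProduct.mapL_smul_right,
      smul_apply, HTensor.mk_smul]

end OpTensor

/-! ### Elementary tensors in the exterior tensor product -/

section Tmul

variable {B C E G : Type*}
  [NonUnitalCStarAlgebra B] [PartialOrder B] [StarOrderedRing B]
  [NonUnitalCStarAlgebra C] [PartialOrder C] [StarOrderedRing C]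
  [NormedAddCommGroup E] [NormedSpace ℂ E] [SMul Bᵐᵒᵖ E] [CStarModule Bᵐᵒᵖ E]
  [NormedAddCommGroup G] [NormedSpace ℂ G] [SMul Cᵐᵒᵖ G] [CStarModule Cᵐᵒᵖ G]

lemma norm_tmul_le (e : E) (g : G) : ‖(tmul e g : ExtTensor B C E G)‖ ≤ ‖e‖ * ‖g‖ :=
  ModBlocks.norm_le (by positivity) fun i => (norm_opTensor_le _ _).trans
    (mul_le_mul (norm_θ_le _ _) (norm_θ_le _ _) (norm_nonneg _) (norm_nonneg _))

variable (B C E G) in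
/-- The elementary tensors as a continuous bilinear map. -/
def tmulL : E →L[ℂ] G →L[ℂ] ExtTensor B C E G :=
  LinearMap.mkContinuous₂
    (LinearMap.mk₂ ℂ tmul
      (fun e e' g => Subtype.ext <| ModBlocks.ext fun i => by
        change opTensor (θ i.1 (e + e')) (θ i.2 g) = _
        rw [θ_add, opTensor_add_left]; rfl)
      (fun z e g => Subtype.ext <| ModBlocks.ext fun i => by
        change opTensor (θ i.1 (z • e)) (θ i.2 g) = _
        rw [θ_smul, opTensor_smul_left]; rfl)
      (fun e g g' => Subtype.ext <| ModBlocks.ext fun i => by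
        change opTensor (θ i.1 e) (θ i.2 (g + g')) = _
        rw [θ_add, opTensor_add_right]; rfl)
      (fun z e g => Subtype.ext <| ModBlocks.ext fun i => by
        change opTensor (θ i.1 e) (θ i.2 (z • g)) = _
        rw [θ_smul, opTensor_smul_right]; rfl)) 1
    fun e g => by rw [one_mul]; exact norm_tmul_le e g

lemma dense_span_tmul :
    Dense (Submodule.span ℂ (Set.range fun p : E × G => (tmul p.1 p.2 : ExtTensor B C E G)) :
      Set (ExtTensor B C E G)) := by
  intro T
  refine (closure_subtype (p := (· ∈ extTensor B C E G)) (x := T)).mpr ?_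
  have h : T.1 ∈ closure ((Submodule.span ℂ (Set.range fun p : E × G => modTmul p.1 p.2) :
    Submodule ℂ (ModBlocks B C E G)) : Set (ModBlocks B C E G)) := T.2
  refine closure_mono ?_ h
  have h2 : Submodule.span ℂ (Set.range fun p : E × G => modTmul p.1 p.2) ≤
      Submodule.map (extTensor B C E G).subtype
        (Submodule.span ℂ (Set.range fun p : E × G => (tmul p.1 p.2 : ExtTensor B C E G))) := by
    rw [Submodule.span_le]
    rintro _ ⟨p, rfl⟩
    exact ⟨tmul p.1 p.2, Submodule.subset_span ⟨p, rfl⟩, rfl⟩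
  exact h2

lemma ketBra_tmul (e₁ e₂ e : E) (g₁ g₂ g : G) :
    ketBra (MinTensor B C) (tmul e₁ g₁ : ExtTensor B C E G) (tmul e₂ g₂) (tmul e g) =
      tmul (ketBra B e₁ e₂ e) (ketBra C g₁ g₂ g) := by
  rw [ketBra, rinner_tmul, tmul_act, ketBra, ketBra]

end Tmul

/-! ### Rank one operators and the left action -/

section KetBra

variable {B E : Type*} [NonUnitalCStarAlgebra B] [PartialOrder B]
  [NormedAddCommGroup E] [NormedSpace ℂ E] [SMul Bᵐᵒᵖ E] [CStarModule Bᵐᵒᵖ E]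

lemma ketBra_zero_left (e f : E) : ketBra B 0 e f = 0 :=
  rinner_ext (B := B) fun g => by simp [ketBra, rinner]

lemma ketBra_zero_right (e f : E) : ketBra B e 0 f = 0 :=
  rinner_ext (B := B) fun g => by simp [ketBra, rinner]

/-- Testing against `g` moves `a` to the other side, so right `B`-linearity of the action is a
consequence of adjointability. -/
lemma LeftAction.ketBra_apply {A : Type*} [CStarAlgebra A] (act : LeftAction A B E) (a : A)
    (e₁ e₂ e : E) : ketBra B (act.toAlgHom a e₁) (act.toAlgHom a e₂) e =
      act.toAlgHom a (ketBra B e₁ e₂ (act.toAlgHom (star a) e)) :=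
  rinner_ext (B := B) fun g => by
    have h : ∀ f, rinner B g (act.toAlgHom a f) = rinner B (act.toAlgHom (star a) g) f :=
      fun f => by rw [act.rinner_apply_left, star_star]
    rw [ketBra, ketBra, rinner_act_right, h e₁, h, rinner_act_right,
      act.rinner_apply_left a e₂ e]

end KetBra

end HilbertMod

end

/-! ### The resolution of the identity -/

theorem mainTheorem1 {A B C E G X : Type*}
    [CStarAlgebra A]
    [CStarAlgebra B] [PartialOrder B] [StarOrderedRing B]
    [NonUnitalCStarAlgebra C] [PartialOrder C] [StarOrderedRing C]
    [NormedAddCommGroup E] [NormedSpace ℂ E] [CompleteSpace E] [SMul Bᵐᵒᵖ E] [CStarModule Bᵐᵒᵖ E]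
    [NormedAddCommGroup G] [NormedSpace ℂ G] [CompleteSpace G] [SMul Cᵐᵒᵖ G] [CStarModule Cᵐᵒᵖ G]
    [MeasurableSpace X] (μ : Measure X) [IsFiniteMeasure μ]
    (act : HilbertMod.LeftAction A B E)
    (N : ℕ∞) (F : ℕ → X → E) (φ : ℕ → G)
    (hF : ∀ k : ℕ, (k : ℕ∞) < N → HilbertMod.SqIntegrable B μ (F k))
    (horth : ∀ k l : ℕ, (k : ℕ∞) < N → (l : ℕ∞) < N →
      HilbertMod.HasWeakOpIntegral μ (fun x => HilbertMod.ketBra B (F k x) (F l x))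
        (fun e => if k = l then e else 0))
    (hφ : ∀ g : G, HilbertMod.HasSeriesSum N (fun k => HilbertMod.ketBra C (φ k) (φ k) g) g)
    (a : A) (ha : a * star a = 1)
    (cs : X → HilbertMod.ExtTensor B C E G)
    (hcs : ∀ x : X, HilbertMod.HasSeriesSum N
      (fun k => HilbertMod.tmul (act.toAlgHom a (F k x)) (φ k)) (cs x)) :
    HilbertMod.HasWeakOpIntegral μ
      (fun x => HilbertMod.ketBra (HilbertMod.MinTensor B C) (cs x) (cs x)) (fun h => h) := by
  have haa : ∀ e, act.toAlgHom a (act.toAlgHom (star a) e) = e := fun e => by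
    rw [← mul_apply_eq_comp, ← map_mul, ha, map_one, one_apply_eq_self]
  simp only [HilbertMod.HasSeriesSum, Finset.sum_filter] at hcs hφ
  refine HilbertMod.hasWeakOpIntegral_ketBra_of_orthogonal
    -- Padding by zero beyond `N` treats finite and infinite families alike.
    (u := fun k x => if (k : ℕ∞) < N then HilbertMod.tmul (act.toAlgHom a (F k x)) (φ k) else 0)
    (fun k => ?_) hcs HilbertMod.dense_span_tmul ?_
  · split_ifs with hk
    · exact (((HilbertMod.tmulL B C E G).flip (φ k) ∘L act.toAlgHom a).continuous
        ).comp_aestronglyMeasurable (hF k hk).aestronglyMeasurable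
    · exact aestronglyMeasurable_const
  · rintro _ ⟨⟨e, g⟩, rfl⟩
    refine ⟨fun k => HilbertMod.tmul e
      (if (k : ℕ∞) < N then HilbertMod.ketBra C (φ k) (φ k) g else 0), ?_, fun k l => ?_⟩
    · refine (((HilbertMod.tmulL B C E G e).continuous.tendsto g).comp (hφ g)).congr fun n => ?_
      simp only [Function.comp_apply, map_sum]
      rfl
    · have htz : (HilbertMod.tmul e 0 : HilbertMod.ExtTensor B C E G) = 0 :=
        map_zero (HilbertMod.tmulL B C E G e)
      by_cases hk : (k : ℕ∞) < N
      · by_cases hl : (l : ℕ∞) < N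
        · simp only [if_pos hk, if_pos hl, HilbertMod.ketBra_tmul, act.ketBra_apply]
          intro v Λ
          -- Orthogonality of the `F k` is applied to the vector `a⋆ e` and the functional `e' ↦ Λ
          -- (a e' ⊗ |φ k⟩⟨φ l| g)`; for `k = l` the value contains `a a⋆ e = e`.
          have h := horth k l hk hl (act.toAlgHom (star a) e)
            (Λ ∘L (HilbertMod.tmulL B C E G).flip (HilbertMod.ketBra C (φ k) (φ l) g) ∘L
              act.toAlgHom a)
          refine ⟨h.1, h.2.trans ?_⟩
          split_ifs with hkl
          · subst hkl
            simp only [ContinuousLinearMap.comp_apply, haa]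
            rfl
          · simp
        · have hkl : k ≠ l := by rintro rfl; exact hl hk
          intro v Λ
          simp [if_neg hl, HilbertMod.ketBra_zero_right, hkl]
      · intro v Λ
        simp [if_neg hk, HilbertMod.ketBra_zero_left, htz]
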